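/- Let $\mu$ be a probability measure on $\mathsf X=\mathbb R^n$ with its Borel $\sigma$-algebra, with $\mu(\{x\})\neq 1$ for every $x\in\mathsf X$. Let $q$ be a Markov kernel on $\mathsf X$ with $q(x,\{x\})=0$ for every $x$, let $\alpha:\mathsf X\times\mathsf X\to[0,1]$ be measurable, and put $$P(x,\mathrm dy)=q(x,\mathrm dy)\,\alpha(x,y)+\{1-\varrho(x)\}\,\delta_x(\mathrm dy),\qquad \varrho(x)=\int q(x,\mathrm dy)\,\alpha(x,y),$$ $$\widetilde P(x,\mathrm dy)=\frac{q(x,\mathrm dy)\,\alpha(x,y)}{\varrho(x)},\qquad \widetilde\mu(\mathrm dx)=\frac{\mu(\mathrm dx)\,\varrho(x)}{\mu(\varrho)},$$ where $\nu(f)=\int f\,\mathrm d\nu$. Assume that $P$ is $\mu$-reversible, and that $P$ and $\widetilde P$ are ergodic with respect to $\mu$ and $\widetilde\mu$ respectively. Here a kernel $\Pi$ is called ergodic with respect to $\nu$ if it is $\nu$-invariant and there is a non-zero $\sigma$-finite measure $\psi$ such that for every $x$ and every measurable $A$ with $\psi(A)>0$ there is $m\ge1$ with $\Pi^m(x,A)>0$.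 (Ergodicity of $P$ implies $\varrho(x)>0$ for every $x$.) For a probability measure $\nu$, a $\nu$-reversible kernel $\Pi$ and $f\in L^2(\nu)$ put $\bar f=f-\nu(f)$, $\phi_m(f,\Pi)=\langle\bar f,\Pi^m\bar f\rangle_\nu/\nu(\bar f^2)$ (read as $0$ for all $m$ if $\nu(\bar f^2)=0$), and $\mathrm{IF}(f,\Pi)=1+2\sum_{m\ge1}\phi_m(f,\Pi)$, where the series is understood in the sense of Abel summation, i.e. $\sum_{m\ge1}\phi_m=\lim_{r\uparrow1}\sum_{m\ge1}\phi_m r^m$; this is the ordinary sum whenever the series converges. Let $L^2_0(\nu)$ be the set of $f\in L^2(\nu)$ with $\nu(f)=0$. Let $h\in L^2_0(\mu)$ with $\mathrm{IF}(h,P)<\infty$. Then $h/\varrho\in L^2_0(\widetilde\mu)$, $\mathrm{IF}(h/\varrho,\widetilde P)$ is finite, $$\mu(h^2)\{1+\mathrm{IF}(h,P)\}=\mu(\varrho)\,\widetilde\mu(h^2/\varrho^2)\{1+\mathrm{IF}(h/\varrho,\widetilde P)\},$$ and $\mathrm{IF}(h/\varrho,\widetilde P)\le\mathrm{IF}(h,P)$.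 -/

import Mathlib

open MeasureTheory ProbabilityTheory Filter Topology

noncomputable section

namespace MHJump

variable {X : Type*} [MeasurableSpace X]

/-- A Markov kernel is irreducible if, for some non-zero `σ`-finite measure `ψ`, every set of
positive `ψ`-measure is reached with positive probability in some number `n ≥ 1` of steps,
from every starting point. -/
def IsPsiIrreducible (Q : Kernel X X) : Prop :=
  ∃ ψ : Measure X, SigmaFinite ψ ∧ ψ ≠ 0 ∧
    ∀ (x : X) (A : Set X), MeasurableSet A → 0 < ψ A → ∃ n : ℕ, 1 ≤ n ∧ 0 < (Q ^ n) x A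

/-- A kernel is ergodic (for `μ`) if it is `μ`-invariant and `ψ`-irreducible for some `ψ`. -/
def IsErgodic (μ : Measure X) (Q : Kernel X X) : Prop :=
  Q.Invariant μ ∧ IsPsiIrreducible Q

/-- `f ∈ L²₀(μ)`: `f` is square integrable with mean zero. -/
def MemL2Zero (μ : Measure X) (f : X → ℝ) : Prop :=
  MemLp f 2 μ ∧ ∫ x, f x ∂μ = 0

/-- The lag-`n` autocorrelation `⟨h̄, Qⁿ h̄⟩_μ / μ(h̄²)`, where `h̄ = h - μ(h)`. It is `0` for all
`n` if `μ(h̄²) = 0`. -/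
def autocorr (μ : Measure X) (Q : Kernel X X) (h : X → ℝ) (n : ℕ) : ℝ :=
  (∫ x, (h x - ∫ z, h z ∂μ) * (∫ y, (h y - ∫ z, h z ∂μ) ∂((Q ^ n) x)) ∂μ) /
    ∫ x, (h x - ∫ z, h z ∂μ) ^ 2 ∂μ

/-- The inefficiency `1 + 2 ∑_{n ≥ 1} φₙ(h, Q)` is finite and equal to `v`.

The series is summed in the sense of Abel, `lim_{r ↑ 1} ∑ φₙ rⁿ`. This is its ordinary sum whenever
it converges (see `hasInefficiency_of_tendsto`), and for a reversible `Q` it is always the spectral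
integral `∫ (1 + λ) / (1 - λ) e(dλ)`, where `φₙ = ∫ λⁿ e(dλ)`, also when `e` charges `-1`, as
happens for chains of period two, whose correlation series oscillates. -/
def HasInefficiency (μ : Measure X) (Q : Kernel X X) (h : X → ℝ) (v : ℝ) : Prop :=
  Tendsto (fun r : ℝ => 1 + 2 * ∑' n : ℕ, autocorr μ Q h (n + 1) * r ^ (n + 1)) (𝓝[<] 1) (𝓝 v)

/-- If the series of autocorrelations converges, the inefficiency is given by its sum. -/
theorem hasInefficiency_of_tendsto {μ : Measure X} {Q : Kernel X X} {h : X → ℝ} {s : ℝ}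
    (hs : Tendsto (fun N : ℕ => ∑ n ∈ Finset.range N, autocorr μ Q h (n + 1)) atTop (𝓝 s)) :
    HasInefficiency μ Q h (1 + 2 * s) := by
  have h1 := Real.tendsto_tsum_powerSeries_nhdsWithin_lt hs
  have h2 : Tendsto (fun r : ℝ => r) (𝓝[<] 1) (𝓝 1) := tendsto_nhdsWithin_of_tendsto_nhds tendsto_id
  have h3 := ((h2.mul h1).const_mul 2).const_add 1
  rw [one_mul] at h3
  refine h3.congr fun r => ?_
  rw [← tsum_mul_left]
  congr 3
  ext n
  ring

/-- The acceptance rate `ϱ(x) = ∫ q(x, dy) α(x, y)`. -/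
def acceptRate (q : Kernel X X) (α : X → X → ℝ) (x : X) : ℝ :=
  ∫ y, α x y ∂(q x)

/-- The Metropolis–Hastings type kernel
`P(x, dy) = q(x, dy) α(x, y) + (1 - ϱ(x)) δₓ(dy)`. -/
def mhKernel (q : Kernel X X) [IsMarkovKernel q] (α : X → X → ℝ) : Kernel X X :=
  q.withDensity (fun x y => ENNReal.ofReal (α x y)) +
    (Kernel.id : Kernel X X).withDensity (fun x _ => ENNReal.ofReal (1 - acceptRate q α x))

/-- The jump kernel `P̃(x, dy) = q(x, dy) α(x, y) / ϱ(x)`. -/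
def jumpKernel (q : Kernel X X) [IsMarkovKernel q] (α : X → X → ℝ) : Kernel X X :=
  q.withDensity (fun x y => ENNReal.ofReal (α x y / acceptRate q α x))

/-- The measure `μ̃(dx) = μ(dx) ϱ(x) / μ(ϱ)`. -/
def jumpMeasure (q : Kernel X X) (α : X → X → ℝ) (μ : Measure X) : Measure X :=
  μ.withDensity (fun x => ENNReal.ofReal (acceptRate q α x / ∫ z, acceptRate q α z ∂μ))

end MHJump

end

/-! For a symmetric contraction `A`, the Abel sum of ⟨h, Aⁿh⟩ over n ≥ 0 is the supremum over f of
2⟨h, f⟩ - ⟨f, (1 - A)f⟩ (`tendsto_tsum_inner_pow_iff_isLUB`). On L²(μ) this sum equals μ(h²)(1 +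
IF)/2, so the inefficiency is read off from a supremum (`hasInefficiency_iff_isLUB`).

Since Pf - f = ϱ(P̃f - f), the weight ϱ turns μ into μ(ϱ)μ̃: the Dirichlet form of P is μ(ϱ) times
that of P̃, and μ(hf) = μ(ϱ) μ̃((h/ϱ)f). The two functionals are thus proportional on L²(μ)
(`variationalFunctional_mhKernel`). The suprema match too, because L²(μ) ⊆ L²(μ̃) and simple
functions, which lie in both, are dense in L²(μ̃). This is the stated identity.

That h/ϱ lies in L²(μ̃) comes from truncations of h/(2ϱ) as test functions
(`integrable_sq_div_acceptRate`). The inequality follows from μ(ϱ)μ̃(h²/ϱ²) = μ(h²/ϱ) ≥ μ(h²) and 1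
+ IF ≥ 0. Division by ϱ is legitimate because a zero of ϱ would be an absorbing point, forcing μ to
be a point mass (`acceptRate_pos`). -/

/-! ### Abel sums for symmetric contractions of a Hilbert space. -/

section Resolvent

open scoped InnerProductSpace

variable {H : Type*} [NormedAddCommGroup H] [InnerProductSpace ℝ H]

/-- For a contraction `A`, the inner product `⟪f, A f⟫` is at most `‖f‖ ^ 2`. -/
theorem abs_inner_map_self_le_of_norm_le_one {A : H →L[ℝ] H} (hA : ‖A‖ ≤ 1) (f : H) :
    |⟪f, A f⟫_ℝ| ≤ ⟪f, f⟫_ℝ := by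
  rw [real_inner_self_eq_norm_mul_norm]
  refine (abs_real_inner_le_norm _ _).trans ?_
  gcongr
  simpa using A.le_of_opNorm_le hA f

variable [CompleteSpace H]

/-- The Neumann series solves `f - r A f = h`. -/
theorem exists_resolvent_eq_tsum {A : H →L[ℝ] H} (hA : ‖A‖ ≤ 1) (h : H) {r : ℝ} (hr0 : 0 ≤ r)
    (hr1 : r < 1) :
    ∃ f : H, f - r • A f = h ∧
      Summable (fun n : ℕ => ⟪h, (A ^ n) h⟫_ℝ * r ^ n) ∧
      ∑' n : ℕ, ⟪h, (A ^ n) h⟫_ℝ * r ^ n = ⟪h, f⟫_ℝ := by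
  have hB : ‖r • A‖ < 1 := by
    rw [norm_smul, Real.norm_of_nonneg hr0]
    nlinarith [norm_nonneg A]
  have hs : Summable (fun n : ℕ => (r • A) ^ n) := summable_geometric_of_norm_lt_one hB
  have hmul : (1 - r • A) * ∑' n : ℕ, (r • A) ^ n = 1 := mul_neg_geom_series _ hB
  have hsum := hs.hasSum
  let L : (H →L[ℝ] H) →L[ℝ] ℝ := (innerSL ℝ h).comp (ContinuousLinearMap.apply ℝ H h)
  have hL := L.hasSum hsum
  have hterm : ∀ n : ℕ, L ((r • A) ^ n) = ⟪h, (A ^ n) h⟫_ℝ * r ^ n := fun n => by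
    simp [L, smul_pow, mul_comm]
  simp only [hterm] at hL
  refine ⟨(∑' n : ℕ, (r • A) ^ n) h, ?_, hL.summable, ?_⟩
  · have := congrArg (fun B : H →L[ℝ] H => B h) hmul
    simpa using this
  · rw [hL.tsum_eq]
    simp [L]

/-- Variational lower bound for the resolvent of a symmetric contraction. -/
theorem le_tsum_inner_pow {A : H →L[ℝ] H} (hA : ‖A‖ ≤ 1)
    (hsymm : ∀ f g, ⟪A f, g⟫_ℝ = ⟪f, A g⟫_ℝ) (h f : H) {r : ℝ} (hr0 : 0 ≤ r) (hr1 : r < 1) :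
    2 * ⟪h, f⟫_ℝ - (⟪f, f⟫_ℝ - r * ⟪f, A f⟫_ℝ) ≤ ∑' n : ℕ, ⟪h, (A ^ n) h⟫_ℝ * r ^ n := by
  obtain ⟨u, hu, -, hsum⟩ := exists_resolvent_eq_tsum hA h hr0 hr1
  rw [hsum]
  -- Completing the square: with h = (1 - rA)u, this form is exactly the gap between ⟨h, u⟩ and the
  -- functional at f.
  have hpos : 0 ≤ ⟪f - u, f - u⟫_ℝ - r * ⟪f - u, A (f - u)⟫_ℝ := by
    have h1 := abs_inner_map_self_le_of_norm_le_one hA (f - u)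
    have h2 := le_abs_self ⟪f - u, A (f - u)⟫_ℝ
    have h3 : 0 ≤ ⟪f - u, f - u⟫_ℝ := real_inner_self_nonneg
    nlinarith
  have e1 : ⟪h, f⟫_ℝ = ⟪u, f⟫_ℝ - r * ⟪u, A f⟫_ℝ := by
    rw [← hu, inner_sub_left, inner_smul_left, hsymm]
    rfl
  have e2 : ⟪h, u⟫_ℝ = ⟪u, u⟫_ℝ - r * ⟪u, A u⟫_ℝ := by
    conv_lhs => rw [← hu]
    rw [inner_sub_left, inner_smul_left, hsymm]
    rfl
  have e3 : ⟪f, A u⟫_ℝ = ⟪u, A f⟫_ℝ := by rw [← hsymm, real_inner_comm]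
  simp only [map_sub, inner_sub_left, inner_sub_right] at hpos
  rw [real_inner_comm u f, e3] at hpos
  rw [e1, e2]
  linarith

/-- Variational upper bound for the resolvent of a symmetric contraction. -/
theorem mul_tsum_inner_pow_le {A : H →L[ℝ] H} (hA : ‖A‖ ≤ 1) (h : H) {S : ℝ}
    (hS : ∀ f, 2 * ⟪h, f⟫_ℝ - ⟪f, f - A f⟫_ℝ ≤ S) {r : ℝ} (hr0 : 0 ≤ r) (hr1 : r < 1) :
    r * ∑' n : ℕ, ⟪h, (A ^ n) h⟫_ℝ * r ^ n ≤ S := by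
  obtain ⟨u, hu, -, hsum⟩ := exists_resolvent_eq_tsum hA h hr0 hr1
  rw [hsum]
  have e2 : ⟪h, u⟫_ℝ = ⟪u, u⟫_ℝ - r * ⟪u, A u⟫_ℝ := by
    rw [real_inner_comm]
    conv_lhs => rw [← hu]
    rw [inner_sub_right, inner_smul_right]
  -- At r • u the terms in ⟨u, Au⟩ cancel: the functional equals r⟨h, u⟩ + r(1 - r)‖u‖².
  have h1 := hS (r • u)
  simp only [map_smul, inner_smul_left, inner_smul_right, inner_sub_right, conj_trivial] at h1
  have h3 : 0 ≤ ⟪u, u⟫_ℝ := real_inner_self_nonneg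
  have h4 : 0 ≤ r * ((1 - r) * ⟪u, u⟫_ℝ) := by
    have : 0 ≤ 1 - r := by linarith
    positivity
  nlinarith

/-- The Abel limit of `∑ ⟪h, Aⁿ h⟫` is `sup_f (2 ⟪h, f⟫ - ⟪f, (1 - A) f⟫)`. -/
theorem tendsto_tsum_inner_pow_iff_isLUB {A : H →L[ℝ] H} (hA : ‖A‖ ≤ 1)
    (hsymm : ∀ f g, ⟪A f, g⟫_ℝ = ⟪f, A g⟫_ℝ) (h : H) (S : ℝ) :
    Tendsto (fun r : ℝ => ∑' n : ℕ, ⟪h, (A ^ n) h⟫_ℝ * r ^ n) (𝓝[<] 1) (𝓝 S) ↔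
      IsLUB (Set.range fun f => 2 * ⟪h, f⟫_ℝ - ⟪f, f - A f⟫_ℝ) S := by
  have hIoo : ∀ᶠ r : ℝ in 𝓝[<] 1, r ∈ Set.Ioo (0 : ℝ) 1 := Ioo_mem_nhdsLT one_pos
  have hid : Tendsto (fun r : ℝ => r) (𝓝[<] 1) (𝓝 1) :=
    tendsto_nhdsWithin_of_tendsto_nhds tendsto_id
  have hlim : ∀ f : H, Tendsto (fun r : ℝ => 2 * ⟪h, f⟫_ℝ - (⟪f, f⟫_ℝ - r * ⟪f, A f⟫_ℝ)) (𝓝[<] 1)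
      (𝓝 (2 * ⟪h, f⟫_ℝ - ⟪f, f - A f⟫_ℝ)) := fun f => by
    rw [inner_sub_right]
    simpa using ((hid.mul_const ⟪f, A f⟫_ℝ).const_sub ⟪f, f⟫_ℝ).const_sub (2 * ⟪h, f⟫_ℝ)
  constructor
  · intro hT
    refine ⟨?_, fun S' hS' => ?_⟩
    · rintro _ ⟨f, rfl⟩
      exact le_of_tendsto_of_tendsto (hlim f) hT
        (hIoo.mono fun r hr => le_tsum_inner_pow hA hsymm h f hr.1.le hr.2)
    · have h1 := hid.mul hT
      rw [one_mul] at h1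
      exact le_of_tendsto h1 (hIoo.mono fun r hr =>
        mul_tsum_inner_pow_le hA h (fun f => hS' ⟨f, rfl⟩) hr.1.le hr.2)
  · intro hS
    refine tendsto_order.2 ⟨fun a ha => ?_, fun b hb => ?_⟩
    · obtain ⟨_, ⟨f, rfl⟩, hf⟩ := (lt_isLUB_iff hS).1 ha
      filter_upwards [hIoo, (hlim f).eventually_const_lt hf] with r hr hr'
      exact hr'.trans_le (le_tsum_inner_pow hA hsymm h f hr.1.le hr.2)
    · have h2 : Tendsto (fun r : ℝ => r * b) (𝓝[<] 1) (𝓝 b) := by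
        simpa using hid.mul_const b
      filter_upwards [hIoo, h2.eventually_const_lt hb] with r hr hr'
      have h1 := mul_tsum_inner_pow_le hA h (fun f => hS.1 ⟨f, rfl⟩) hr.1.le hr.2
      exact lt_of_mul_lt_mul_left (h1.trans_lt hr') hr.1.le

end Resolvent

/-! ### Markov kernels as contractions of L²(μ). -/

namespace ProbabilityTheory.Kernel

variable {X : Type*} [MeasurableSpace X] {μ : Measure X} {κ : Kernel X X}

/-- If `κ` is reversible for `μ`, then `μ ⊗ₘ κ` is a symmetric measure. -/
theorem IsReversible.measurePreserving_swap [IsFiniteMeasure μ] [IsMarkovKernel κ]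
    (hκ : κ.IsReversible μ) : MeasurePreserving Prod.swap (μ ⊗ₘ κ) (μ ⊗ₘ κ) := by
  refine ⟨measurable_swap, Measure.ext_prod fun {s} {t} hs ht => ?_⟩
  rw [Measure.map_apply measurable_swap (hs.prod ht), Set.preimage_swap_prod,
    Measure.compProd_apply_prod ht hs, Measure.compProd_apply_prod hs ht]
  exact hκ ht hs

theorem Invariant.measurePreserving_snd [SFinite μ] [IsSFiniteKernel κ]
    (hκ : κ.Invariant μ) : MeasurePreserving Prod.snd (μ ⊗ₘ κ) μ :=
  ⟨measurable_snd, by rw [← Measure.snd, Measure.snd_compProd]; exact hκ⟩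

theorem measurePreserving_fst_compProd (μ : Measure X) (κ : Kernel X X) [SFinite μ]
    [IsMarkovKernel κ] : MeasurePreserving Prod.fst (μ ⊗ₘ κ) μ :=
  ⟨measurable_fst, by rw [← Measure.fst, Measure.fst_compProd]⟩

instance isMarkovKernel_pow [IsMarkovKernel κ] (n : ℕ) : IsMarkovKernel (κ ^ n) := by
  induction n with
  | zero => rw [pow_zero]; exact inferInstanceAs (IsMarkovKernel Kernel.id)
  | succ n ih => rw [pow_add]; simpa using inferInstanceAs (IsMarkovKernel ((κ ^ n) ∘ₖ κ))

theorem Invariant.pow (hκ : κ.Invariant μ) (n : ℕ) : (κ ^ n).Invariant μ := by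
  induction n with
  | zero =>
    rw [pow_zero]
    exact Measure.id_comp
  | succ n ih => simpa [pow_add] using ih.comp hκ

theorem Invariant.ae_integrable (hκ : κ.Invariant μ) [SFinite μ] [IsSFiniteKernel κ] {f : X → ℝ}
    (hf : Integrable f μ) : ∀ᵐ x ∂μ, Integrable f (κ x) := by
  refine Measure.ae_integrable_of_integrable_comp ?_
  rw [show κ ∘ₘ μ = μ from hκ]
  exact hf

theorem Invariant.integrable_integral (hκ : κ.Invariant μ) [SFinite μ] [IsSFiniteKernel κ]
    {f : X → ℝ} (hf : Integrable f μ) : Integrable (fun x => ∫ y, f y ∂κ x) μ := by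
  have hf' : Integrable f (κ ∘ₘ μ) := by rwa [show κ ∘ₘ μ = μ from hκ]
  rw [Measure.comp_eq_comp_const_apply] at hf'
  simpa using hf'.integral_comp

section L2

variable [IsProbabilityMeasure μ] [IsMarkovKernel κ]

/-- The operator `f ↦ ∫ f(y) κ(·, dy)` on `L²(μ)`, for a `μ`-invariant Markov kernel `κ`. -/
noncomputable def Invariant.l2Operator (hκ : κ.Invariant μ) : Lp ℝ 2 μ →L[ℝ] Lp ℝ 2 μ :=
  (ContinuousLinearMap.adjoint (Lp.compMeasurePreservingₗᵢ ℝ Prod.fst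
    (measurePreserving_fst_compProd μ κ)).toContinuousLinearMap).comp
    (Lp.compMeasurePreservingₗᵢ ℝ Prod.snd hκ.measurePreserving_snd).toContinuousLinearMap

open scoped InnerProductSpace

/-- The operator is an isometry followed by the adjoint of an isometry: pull back along the second
coordinate of the stationary pair, then project onto functions of the first. -/
theorem Invariant.norm_l2Operator_le (hκ : κ.Invariant μ) : ‖hκ.l2Operator‖ ≤ 1 := by
  refine (ContinuousLinearMap.opNorm_comp_le _ _).trans ?_
  rw [LinearIsometryEquiv.norm_map]
  exact mul_le_one₀ (LinearIsometry.norm_toContinuousLinearMap_le _) (norm_nonneg _)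
    (LinearIsometry.norm_toContinuousLinearMap_le _)

theorem Invariant.inner_l2Operator (hκ : κ.Invariant μ) (f g : Lp ℝ 2 μ) :
    ⟪f, hκ.l2Operator g⟫_ℝ = ∫ z, f z.1 * g z.2 ∂(μ ⊗ₘ κ) := by
  rw [l2Operator, ContinuousLinearMap.comp_apply, ContinuousLinearMap.adjoint_inner_right,
    L2.inner_def]
  refine integral_congr_ae ?_
  filter_upwards [Lp.coeFn_compMeasurePreserving f (measurePreserving_fst_compProd μ κ),
    Lp.coeFn_compMeasurePreserving g hκ.measurePreserving_snd] with z h1 h2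
  change inner ℝ (Lp.compMeasurePreserving Prod.fst _ f z)
    (Lp.compMeasurePreserving Prod.snd _ g z) = _
  rw [h1, h2]
  simp [mul_comm]

/-- The form is an integral over the stationary pair, whose law is invariant under the swap. -/
theorem IsReversible.inner_l2Operator_comm (hκ : κ.IsReversible μ) (f g : Lp ℝ 2 μ) :
    ⟪hκ.invariant.l2Operator f, g⟫_ℝ = ⟪f, hκ.invariant.l2Operator g⟫_ℝ := by
  rw [real_inner_comm, hκ.invariant.inner_l2Operator, hκ.invariant.inner_l2Operator,
    ← hκ.measurePreserving_swap.integral_comp MeasurableEquiv.prodComm.measurableEmbedding]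
  simp [mul_comm]

/-- Both sides have the same integral over every measurable set, seen by pairing with its indicator.
-/
theorem Invariant.coeFn_l2Operator (hκ : κ.Invariant μ) (g : Lp ℝ 2 μ) :
    hκ.l2Operator g =ᵐ[μ] fun x => ∫ y, g y ∂κ x := by
  have hg : Integrable g μ := (Lp.memLp g).integrable one_le_two
  refine Integrable.ae_eq_of_forall_setIntegral_eq _ _ ((Lp.memLp _).integrable one_le_two)
    (hκ.integrable_integral hg) fun s hs hμs => ?_
  have hg2 : Integrable (fun z : X × X => g z.2) (μ ⊗ₘ κ) :=
    hκ.measurePreserving_snd.integrable_comp_of_integrable hg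
  rw [← L2.inner_indicatorConstLp_one hs hμs.ne, hκ.inner_l2Operator]
  have h1 : ∫ z, indicatorConstLp 2 hs hμs.ne (1 : ℝ) z.1 * g z.2 ∂(μ ⊗ₘ κ) =
      ∫ z, (s ×ˢ Set.univ).indicator (fun z : X × X => g z.2) z ∂(μ ⊗ₘ κ) := by
    refine integral_congr_ae ?_
    filter_upwards [(measurePreserving_fst_compProd μ κ).quasiMeasurePreserving.ae
      (indicatorConstLp_coeFn (p := 2) (hs := hs) (hμs := hμs.ne) (c := (1 : ℝ)))] with z hz
    rw [hz]
    by_cases hzs : z.1 ∈ s <;> simp [hzs]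
  rw [h1, integral_indicator (hs.prod .univ),
    Measure.setIntegral_compProd hs .univ hg2.integrableOn]
  simp

theorem Invariant.l2Operator_pow_toLp [MeasurableSingletonClass X] (hκ : κ.Invariant μ) {h : X → ℝ}
    (hh : MemLp h 2 μ) (n : ℕ) :
    (hκ.l2Operator ^ n) (hh.toLp h) =ᵐ[μ] fun x => ∫ y, h y ∂(κ ^ n) x := by
  induction n with
  | zero =>
    filter_upwards [hh.coeFn_toLp] with x hx
    rw [pow_zero, pow_zero, show (1 : Kernel X X) = Kernel.id from rfl, Kernel.id_apply,
      integral_dirac]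
    exact hx
  | succ n ih =>
    rw [pow_succ', mul_apply_eq_comp]
    have hint : Integrable h μ := hh.integrable one_le_two
    -- By invariance, a μ-null exceptional set is also κ x-null for μ-almost every x.
    have hae := Measure.ae_ae_of_ae_comp (κ := κ) (μ := μ)
      (by rw [show κ ∘ₘ μ = μ from hκ]; exact ih)
    filter_upwards [hκ.coeFn_l2Operator ((hκ.l2Operator ^ n) (hh.toLp h)), hae,
      (hκ.pow (n + 1)).ae_integrable hint] with x hx hx2 hi
    rw [Kernel.pow_add, pow_one] at hi ⊢
    rw [hx, integral_comp hi]
    exact integral_congr_ae hx2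

end L2

end ProbabilityTheory.Kernel

/-! ### The variational formula for the inefficiency. -/

namespace MHJump

variable {X : Type*} [MeasurableSpace X]

/-- The concave functional `f ↦ 2 μ(h f) - μ(f (f - κ f))`, whose supremum is the Abel sum of
the autocovariances of `h` under a reversible kernel `κ`. -/
noncomputable def variationalFunctional (μ : Measure X) (κ : Kernel X X) (h f : X → ℝ) : ℝ :=
  2 * ∫ x, h x * f x ∂μ - ∫ x, f x * (f x - ∫ y, f y ∂κ x) ∂μ

section L2

open scoped InnerProductSpace

variable {μ : Measure X} {κ : Kernel X X}

theorem inner_toLp_toLp {f g : X → ℝ} (hf : MemLp f 2 μ) (hg : MemLp g 2 μ) :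
    ⟪hf.toLp f, hg.toLp g⟫_ℝ = ∫ x, f x * g x ∂μ := by
  rw [L2.inner_def]
  refine integral_congr_ae ?_
  filter_upwards [hf.coeFn_toLp, hg.coeFn_toLp] with x h1 h2
  rw [h1, h2]
  simp [mul_comm]

variable [MeasurableSingletonClass X] [IsProbabilityMeasure μ] [IsMarkovKernel κ]

theorem inner_l2Operator_pow (hκ : κ.Invariant μ) {f g : X → ℝ} (hf : MemLp f 2 μ)
    (hg : MemLp g 2 μ) (n : ℕ) :
    ⟪hf.toLp f, (hκ.l2Operator ^ n) (hg.toLp g)⟫_ℝ = ∫ x, f x * ∫ y, g y ∂(κ ^ n) x ∂μ := by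
  rw [L2.inner_def]
  refine integral_congr_ae ?_
  filter_upwards [hf.coeFn_toLp, hκ.l2Operator_pow_toLp hg n] with x h1 h2
  rw [h1, h2]
  simp [mul_comm]

/-- `κ f ∈ L²(μ)` for `f ∈ L²(μ)`. -/
theorem memLp_integral_kernel (hκ : κ.Invariant μ) {f : X → ℝ} (hf : MemLp f 2 μ) :
    MemLp (fun x => ∫ y, f y ∂κ x) 2 μ := by
  have h := hκ.l2Operator_pow_toLp hf 1
  rw [pow_one, pow_one] at h
  exact (memLp_congr_ae h).1 (Lp.memLp _)

theorem integral_mul_sub_integral_kernel (hκ : κ.Invariant μ) {f : X → ℝ} (hf : MemLp f 2 μ) :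
    ∫ x, f x * (f x - ∫ y, f y ∂κ x) ∂μ =
      ⟪hf.toLp f, hf.toLp f - hκ.l2Operator (hf.toLp f)⟫_ℝ := by
  have h2 := inner_l2Operator_pow hκ hf hf 1
  rw [pow_one, pow_one] at h2
  rw [inner_sub_right, inner_toLp_toLp, h2, ← integral_sub]
  · simp_rw [mul_sub]
  · exact hf.integrable_mul hf
  · exact hf.integrable_mul (memLp_integral_kernel hκ hf)

theorem variationalFunctional_eq (hκ : κ.Invariant μ) {h f : X → ℝ} (hh : MemLp h 2 μ)
    (hf : MemLp f 2 μ) :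
    variationalFunctional μ κ h f = 2 * ⟪hh.toLp h, hf.toLp f⟫_ℝ -
      ⟪hf.toLp f, hf.toLp f - hκ.l2Operator (hf.toLp f)⟫_ℝ := by
  rw [variationalFunctional, inner_toLp_toLp, integral_mul_sub_integral_kernel hκ hf]

theorem range_variationalFunctional (hκ : κ.Invariant μ) {h : X → ℝ} (hh : MemLp h 2 μ) :
    (Set.range fun F : Lp ℝ 2 μ => 2 * ⟪hh.toLp h, F⟫_ℝ - ⟪F, F - hκ.l2Operator F⟫_ℝ) =
      variationalFunctional μ κ h '' {f | MemLp f 2 μ} := by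
  ext s
  constructor
  · rintro ⟨F, rfl⟩
    refine ⟨F, Lp.memLp F, ?_⟩
    rw [variationalFunctional_eq hκ hh (Lp.memLp F), Lp.toLp_coeFn]
  · rintro ⟨f, hf, rfl⟩
    exact ⟨MemLp.toLp f hf, (variationalFunctional_eq hκ hh hf).symm⟩

/-- The Dirichlet form of a Markov kernel is at most twice the squared norm. -/
theorem integral_mul_sub_integral_kernel_le (hκ : κ.Invariant μ) {f : X → ℝ} (hf : MemLp f 2 μ) :
    ∫ x, f x * (f x - ∫ y, f y ∂κ x) ∂μ ≤ 2 * ∫ x, f x * f x ∂μ := by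
  rw [integral_mul_sub_integral_kernel hκ hf, inner_sub_right, ← inner_toLp_toLp hf hf]
  have h1 := abs_inner_map_self_le_of_norm_le_one hκ.norm_l2Operator_le (hf.toLp f)
  have h2 := neg_abs_le ⟪hf.toLp f, hκ.l2Operator (hf.toLp f)⟫_ℝ
  linarith

/-- The inefficiency of a reversible kernel is given by a variational formula. -/
theorem hasInefficiency_iff_isLUB (hκ : κ.IsReversible μ) {h : X → ℝ} (hh : MemL2Zero μ h)
    (hm : ∫ x, h x ^ 2 ∂μ ≠ 0) (v : ℝ) :
    HasInefficiency μ κ h v ↔ IsLUB (variationalFunctional μ κ h '' {f | MemLp f 2 μ})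
      ((∫ x, h x ^ 2 ∂μ) * (1 + v) / 2) := by
  set m := ∫ x, h x ^ 2 ∂μ with hmdef
  rw [← range_variationalFunctional hκ.invariant hh.1,
    ← tendsto_tsum_inner_pow_iff_isLUB hκ.invariant.norm_l2Operator_le hκ.inner_l2Operator_comm]
  set A := hκ.invariant.l2Operator
  set F := hh.1.toLp h
  have hcorr : ∀ n, autocorr μ κ h n = ⟪F, (A ^ n) F⟫_ℝ / m := fun n => by
    rw [inner_l2Operator_pow, autocorr, hh.2]
    simp only [sub_zero, hmdef]
  have h0 : autocorr μ κ h 0 = 1 := by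
    rw [hcorr, pow_zero, one_apply_eq_self, inner_toLp_toLp, div_eq_one_iff_eq hm,
      hmdef]
    simp_rw [sq]
  -- The lag-zero correlation is 1, so starting the series at n = 0 turns 1 + 2∑ into (2/m)∑ - 1;
  -- solving for the sum gives the constant m(1 + v)/2.
  have key : ∀ᶠ r : ℝ in 𝓝[<] 1, 1 + 2 * ∑' n : ℕ, autocorr μ κ h (n + 1) * r ^ (n + 1) =
      2 / m * (∑' n : ℕ, ⟪F, (A ^ n) F⟫_ℝ * r ^ n) - 1 := by
    filter_upwards [Ioo_mem_nhdsLT (one_pos (α := ℝ))] with r hr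
    obtain ⟨-, -, hs, -⟩ :=
      exists_resolvent_eq_tsum hκ.invariant.norm_l2Operator_le F hr.1.le hr.2
    have hs' : Summable fun n : ℕ => autocorr μ κ h n * r ^ n := by
      refine (hs.div_const m).congr fun n => ?_
      rw [hcorr]
      ring
    have h1 : ∑' n : ℕ, autocorr μ κ h n * r ^ n = (∑' n : ℕ, ⟪F, (A ^ n) F⟫_ℝ * r ^ n) / m := by
      rw [← tsum_div_const]
      refine tsum_congr fun n => ?_
      rw [hcorr]
      ring
    have h2 := hs'.tsum_eq_zero_add
    rw [h1, h0, pow_zero, mul_one] at h2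
    have h3 : ∑' n : ℕ, autocorr μ κ h (n + 1) * r ^ (n + 1) =
      (∑' n : ℕ, ⟪F, (A ^ n) F⟫_ℝ * r ^ n) / m - 1 := by linarith
    rw [h3]
    ring
  rw [HasInefficiency, tendsto_congr' key]
  constructor
  · intro hT
    refine ((hT.add_const 1).const_mul (m / 2)).congr' ?_ |>.trans_eq ?_
    · exact Eventually.of_forall fun r => by field_simp; ring
    · congr 1; ring
  · intro hT
    refine ((hT.const_mul (2 / m)).sub_const 1).trans_eq ?_
    congr 1
    field_simp
    ring

/-- The variational functional on `L²(μ)` is bounded by its bound on any space of functions that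
contains the simple functions. -/
theorem variationalFunctional_le_of_forall_simpleFunc (hκ : κ.Invariant μ) {h : X → ℝ}
    (hh : MemLp h 2 μ) {S : ℝ}
    (hS : ∀ f : SimpleFunc X ℝ, variationalFunctional μ κ h f ≤ S) {f : X → ℝ}
    (hf : MemLp f 2 μ) : variationalFunctional μ κ h f ≤ S := by
  -- The functional is continuous on L², so the bound passes from the dense simple functions to
  -- their closure.
  have hclosed : IsClosed {F : Lp ℝ 2 μ |
      2 * ⟪hh.toLp h, F⟫_ℝ - ⟪F, F - hκ.l2Operator F⟫_ℝ ≤ S} :=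
    isClosed_le (by fun_prop) continuous_const
  have hall : ∀ F : Lp ℝ 2 μ, 2 * ⟪hh.toLp h, F⟫_ℝ - ⟪F, F - hκ.l2Operator F⟫_ℝ ≤ S := by
    intro F
    refine (Lp.simpleFunc.denseRange (E := ℝ) (p := 2) (μ := μ) (by norm_num)).induction_on
      (p := fun F => 2 * ⟪hh.toLp h, F⟫_ℝ - ⟪F, F - hκ.l2Operator F⟫_ℝ ≤ S) F hclosed fun G => ?_
    have hG : MemLp (Lp.simpleFunc.toSimpleFunc G) 2 μ := SimpleFunc.memLp_of_isFiniteMeasure _ _ _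
    have hGe : hG.toLp _ = (G : Lp ℝ 2 μ) := by
      rw [← Lp.toLp_coeFn (G : Lp ℝ 2 μ) (Lp.memLp _)]
      exact MemLp.toLp_congr _ _ (Lp.simpleFunc.toSimpleFunc_eq_toFun G)
    rw [← hGe, ← variationalFunctional_eq hκ hh hG]
    exact hS _
  rw [variationalFunctional_eq hκ hh hf]
  exact hall _

end L2

/-- Division by zero returns 0, so every correlation vanishes, as the convention for constant
functions requires. -/
theorem hasInefficiency_one_of_integral_sq_eq_zero {μ : Measure X} {κ : Kernel X X} {h : X → ℝ}
    (hh : ∫ x, h x ∂μ = 0) (hm : ∫ x, h x ^ 2 ∂μ = 0) : HasInefficiency μ κ h 1 := by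
  have : ∀ n, autocorr μ κ h n = 0 := fun n => by simp [autocorr, hh, hm]
  simp [HasInefficiency, this]

end MHJump

/-! ### Absorbing points of irreducible chains. -/

namespace MHJump

variable {X : Type*} [MeasurableSpace X]

/-- If an irreducible chain with invariant probability measure `μ` has an absorbing point, then
`μ` is concentrated at that point. -/
theorem IsErgodic.measure_singleton_eq_one [MeasurableSingletonClass X] {μ : Measure X}
    [IsProbabilityMeasure μ] {κ : Kernel X X} [IsMarkovKernel κ] (hκ : IsErgodic μ κ) {x : X}
    (hx : κ x = Measure.dirac x) : μ {x} = 1 := by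
  obtain ⟨hinv, ψ, -, hψ0, hψ⟩ := hκ
  have hpow : ∀ n : ℕ, (κ ^ n) x = Measure.dirac x := by
    intro n
    induction n with
    | zero =>
      rw [pow_zero, show (1 : Kernel X X) = Kernel.id from rfl, Kernel.id_apply]
    | succ n ih =>
      ext s hs
      rw [Kernel.pow_succ_apply_eq_lintegral _ _ _ hs, ih, lintegral_dirac, hx]
  have hxm : MeasurableSet ({x} : Set X) := measurableSet_singleton x
  -- The chain started at x never leaves, so ψ cannot charge the complement.
  have hψc : ψ {x}ᶜ = 0 := by
    by_contra hne
    obtain ⟨n, -, hn⟩ := hψ x _ hxm.compl (pos_iff_ne_zero.2 hne)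
    rw [hpow n] at hn
    simp at hn
  have hψx : 0 < ψ {x} := by
    refine pos_iff_ne_zero.2 fun h0 => hψ0 ?_
    rw [← Measure.measure_univ_eq_zero, ← Set.union_compl_self {x}]
    exact measure_union_null h0 hψc
  -- Mass balance: the starting point x alone already supplies all of μ {x}, leaving no inflow from
  -- elsewhere.
  have hae : ∀ n : ℕ, ∀ᵐ y ∂μ.restrict {x}ᶜ, (κ ^ n) y {x} = 0 := by
    intro n
    have h1 : ∫⁻ y, (κ ^ n) y {x} ∂μ = μ {x} := by
      rw [← Measure.bind_apply hxm (Kernel.aemeasurable _)]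
      exact congrArg (fun ν : Measure X => ν {x}) (hinv.pow n)
    rw [← lintegral_add_compl _ hxm, lintegral_singleton, hpow n] at h1
    have h2 : ∫⁻ y in {x}ᶜ, (κ ^ n) y {x} ∂μ = 0 := by
      simpa [measure_ne_top] using h1
    exact (lintegral_eq_zero_iff (Kernel.measurable_coe _ hxm)).1 h2
  have hfalse : ∀ᵐ y ∂μ.restrict {x}ᶜ, False := by
    filter_upwards [ae_all_iff.2 hae] with y hy
    obtain ⟨n, -, hn⟩ := hψ y _ hxm hψx
    exact hn.ne' (hy n)
  rw [← prob_compl_eq_zero_iff hxm, ← Measure.restrict_eq_zero, ← ae_eq_bot]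
  exact eventually_false_iff_eq_bot.1 hfalse

/-! ### The kernels P and P̃ and the measure μ̃. -/

section Kernels

variable {q : Kernel X X} {α : X → X → ℝ}

theorem acceptRate_nonneg (h01 : ∀ x y, 0 ≤ α x y ∧ α x y ≤ 1) (x : X) : 0 ≤ acceptRate q α x :=
  integral_nonneg fun y => (h01 x y).1

variable [IsMarkovKernel q]

theorem measurable_acceptRate (hα : Measurable (Function.uncurry α)) :
    Measurable (acceptRate q α) :=
  (hα.stronglyMeasurable.integral_kernel_prod_right (κ := q)).measurable

theorem integrable_acceptProb (hα : Measurable (Function.uncurry α))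
    (h01 : ∀ x y, 0 ≤ α x y ∧ α x y ≤ 1) (x : X) : Integrable (α x) (q x) :=
  Integrable.of_bound (hα.of_uncurry_left (x := x)).aestronglyMeasurable 1
    (Eventually.of_forall fun y => by
      rw [Real.norm_of_nonneg (h01 x y).1]
      exact (h01 x y).2)

theorem acceptRate_le_one (hα : Measurable (Function.uncurry α))
    (h01 : ∀ x y, 0 ≤ α x y ∧ α x y ≤ 1) (x : X) : acceptRate q α x ≤ 1 := by
  have := integral_mono (integrable_acceptProb (q := q) hα h01 x) (integrable_const 1)
    (fun y => (h01 x y).2)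
  simpa [acceptRate] using this

theorem ofReal_acceptRate (hα : Measurable (Function.uncurry α))
    (h01 : ∀ x y, 0 ≤ α x y ∧ α x y ≤ 1) (x : X) :
    ENNReal.ofReal (acceptRate q α x) = ∫⁻ y, ENNReal.ofReal (α x y) ∂q x :=
  ofReal_integral_eq_lintegral_ofReal (integrable_acceptProb hα h01 x)
    (Eventually.of_forall fun y => (h01 x y).1)

theorem mhKernel_apply_eq (hα : Measurable (Function.uncurry α)) (x : X) :
    mhKernel q α x = (q x).withDensity (fun y => ENNReal.ofReal (α x y)) +
      ENNReal.ofReal (1 - acceptRate q α x) • Measure.dirac x := by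
  have hm : Measurable (acceptRate q α) := measurable_acceptRate hα
  rw [mhKernel, add_apply, Kernel.withDensity_apply _ (by fun_prop),
    Kernel.withDensity_apply _ (by fun_prop), Kernel.id_apply, withDensity_const]

theorem jumpKernel_apply_eq (hα : Measurable (Function.uncurry α)) (x : X) :
    jumpKernel q α x = (q x).withDensity (fun y => ENNReal.ofReal (α x y / acceptRate q α x)) := by
  have hm : Measurable (acceptRate q α) := measurable_acceptRate hα
  have hm2 : Measurable (Function.uncurry fun x y => α x y / acceptRate q α x) :=
    hα.div (hm.comp measurable_fst)
  exact Kernel.withDensity_apply (f := fun x y => ENNReal.ofReal (α x y / acceptRate q α x)) _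
    hm2.ennreal_ofReal x

theorem acceptRate_smul_jumpKernel (hα : Measurable (Function.uncurry α)) {x : X}
    (hx : 0 < acceptRate q α x) :
    ENNReal.ofReal (acceptRate q α x) • jumpKernel q α x =
      (q x).withDensity (fun y => ENNReal.ofReal (α x y)) := by
  have hm : Measurable (α x) := hα.of_uncurry_left
  rw [jumpKernel_apply_eq hα, ← withDensity_smul _ (by fun_prop)]
  congr 1
  ext y
  rw [Pi.smul_apply, smul_eq_mul, ← ENNReal.ofReal_mul hx.le, mul_div_cancel₀ _ hx.ne']

theorem mhKernel_eq_add (hα : Measurable (Function.uncurry α)) {x : X}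
    (hx : 0 < acceptRate q α x) :
    mhKernel q α x = ENNReal.ofReal (acceptRate q α x) • jumpKernel q α x +
      ENNReal.ofReal (1 - acceptRate q α x) • Measure.dirac x := by
  rw [mhKernel_apply_eq hα, acceptRate_smul_jumpKernel hα hx]

theorem isMarkovKernel_mhKernel (hα : Measurable (Function.uncurry α))
    (h01 : ∀ x y, 0 ≤ α x y ∧ α x y ≤ 1) : IsMarkovKernel (mhKernel q α) := by
  refine ⟨fun x => ⟨?_⟩⟩
  rw [mhKernel_apply_eq hα, Measure.add_apply, withDensity_apply _ .univ, Measure.restrict_univ,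
    ← ofReal_acceptRate hα h01, Measure.smul_apply, measure_univ, smul_eq_mul, mul_one,
    ← ENNReal.ofReal_add (acceptRate_nonneg h01 x) (sub_nonneg.2 (acceptRate_le_one hα h01 x))]
  simp

theorem isMarkovKernel_jumpKernel (hα : Measurable (Function.uncurry α))
    (h01 : ∀ x y, 0 ≤ α x y ∧ α x y ≤ 1) (hpos : ∀ x, 0 < acceptRate q α x) :
    IsMarkovKernel (jumpKernel q α) := by
  refine ⟨fun x => ⟨?_⟩⟩
  have h1 := congrArg (fun ν : Measure X => ν Set.univ) (acceptRate_smul_jumpKernel hα (hpos x))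
  simp only [Measure.smul_apply, smul_eq_mul, withDensity_apply _ MeasurableSet.univ,
    Measure.restrict_univ, ← ofReal_acceptRate hα h01] at h1
  exact (ENNReal.mul_eq_left (ENNReal.ofReal_pos.2 (hpos x)).ne' ENNReal.ofReal_ne_top).1 h1

/-- Ergodicity forces the acceptance rate to be positive everywhere. -/
theorem acceptRate_pos [MeasurableSingletonClass X] {μ : Measure X} [IsProbabilityMeasure μ]
    (hμ : ∀ x, μ {x} ≠ 1) (hα : Measurable (Function.uncurry α))
    (h01 : ∀ x y, 0 ≤ α x y ∧ α x y ≤ 1) (hP : IsErgodic μ (mhKernel q α)) (x : X) :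
    0 < acceptRate q α x := by
  refine (acceptRate_nonneg h01 x).lt_of_ne' fun h0 => hμ x ?_
  have := isMarkovKernel_mhKernel (q := q) hα h01
  refine hP.measure_singleton_eq_one ?_
  have h1 := ofReal_acceptRate (q := q) hα h01 x
  have hm : Measurable (α x) := hα.of_uncurry_left
  rw [h0, ENNReal.ofReal_zero, eq_comm, lintegral_eq_zero_iff (by fun_prop)] at h1
  rw [mhKernel_apply_eq hα, withDensity_congr_ae h1, h0]
  simp

/-- Source of Pf - f = ϱ(P̃f - f). Integrability is needed to split the integral. -/
theorem integral_mhKernel [MeasurableSingletonClass X] (hα : Measurable (Function.uncurry α))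
    (h01 : ∀ x y, 0 ≤ α x y ∧ α x y ≤ 1) {x : X} (hx : 0 < acceptRate q α x) {f : X → ℝ}
    (hf : Integrable f (mhKernel q α x)) :
    ∫ y, f y ∂mhKernel q α x =
      acceptRate q α x * ∫ y, f y ∂jumpKernel q α x + (1 - acceptRate q α x) * f x := by
  rw [mhKernel_eq_add hα hx] at hf ⊢
  rw [integrable_add_measure] at hf
  rw [integral_add_measure hf.1 hf.2, integral_smul_measure, integral_smul_measure, integral_dirac,
    ENNReal.toReal_ofReal hx.le, ENNReal.toReal_ofReal (sub_nonneg.2 (acceptRate_le_one hα h01 x))]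
  rfl

section Measure

variable {μ : Measure X}

theorem integral_jumpMeasure (hα : Measurable (Function.uncurry α))
    (h01 : ∀ x y, 0 ≤ α x y ∧ α x y ≤ 1) (f : X → ℝ) :
    ∫ x, f x ∂jumpMeasure q α μ =
      (∫ x, acceptRate q α x * f x ∂μ) / ∫ x, acceptRate q α x ∂μ := by
  have hm : Measurable (acceptRate q α) := measurable_acceptRate hα
  rw [jumpMeasure, integral_withDensity_eq_integral_toReal_smul (by fun_prop)
    (Eventually.of_forall fun x => ENNReal.ofReal_lt_top), ← integral_div]
  refine integral_congr_ae (Eventually.of_forall fun x => ?_)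
  simp only [smul_eq_mul]
  rw [ENNReal.toReal_ofReal (div_nonneg (acceptRate_nonneg h01 x)
    (integral_nonneg fun x => acceptRate_nonneg h01 x))]
  ring

/-- As ϱ ≤ 1, the density of μ̃ is at most 1/μ(ϱ). -/
theorem memLp_jumpMeasure (hα : Measurable (Function.uncurry α))
    (h01 : ∀ x y, 0 ≤ α x y ∧ α x y ≤ 1) {f : X → ℝ}
    (hf : MemLp f 2 μ) : MemLp f 2 (jumpMeasure q α μ) := by
  refine hf.of_measure_le_smul (c := ENNReal.ofReal (1 / ∫ z, acceptRate q α z ∂μ))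
    ENNReal.ofReal_ne_top ?_
  rw [jumpMeasure, ← withDensity_const]
  refine withDensity_mono (Eventually.of_forall fun x => ENNReal.ofReal_le_ofReal ?_)
  exact div_le_div_of_nonneg_right (acceptRate_le_one hα h01 x)
    (integral_nonneg fun x => acceptRate_nonneg h01 x)

variable [IsProbabilityMeasure μ]

theorem integrable_acceptRate (hα : Measurable (Function.uncurry α))
    (h01 : ∀ x y, 0 ≤ α x y ∧ α x y ≤ 1) : Integrable (acceptRate q α) μ :=
  Integrable.of_bound (measurable_acceptRate hα).aestronglyMeasurable 1
    (Eventually.of_forall fun x => by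
      rw [Real.norm_of_nonneg (acceptRate_nonneg h01 x)]
      exact acceptRate_le_one hα h01 x)

theorem integral_acceptRate_pos (hα : Measurable (Function.uncurry α))
    (h01 : ∀ x y, 0 ≤ α x y ∧ α x y ≤ 1) (hpos : ∀ x, 0 < acceptRate q α x) :
    0 < ∫ x, acceptRate q α x ∂μ := by
  rw [integral_pos_iff_support_of_nonneg (fun x => (hpos x).le) (integrable_acceptRate hα h01),
    Function.support_eq_univ (fun x => (hpos x).ne')]
  simp

theorem isProbabilityMeasure_jumpMeasure (hα : Measurable (Function.uncurry α))
    (h01 : ∀ x y, 0 ≤ α x y ∧ α x y ≤ 1) (hpos : ∀ x, 0 < acceptRate q α x) :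
    IsProbabilityMeasure (jumpMeasure q α μ) := by
  have hc := integral_acceptRate_pos (μ := μ) hα h01 hpos
  refine ⟨?_⟩
  rw [jumpMeasure, withDensity_apply _ .univ, Measure.restrict_univ,
    ← ofReal_integral_eq_lintegral_ofReal ((integrable_acceptRate hα h01).div_const _)
      (Eventually.of_forall fun x => div_nonneg (hpos x).le hc.le), integral_div,
    div_self hc.ne', ENNReal.ofReal_one]

theorem integrable_jumpMeasure_iff (hα : Measurable (Function.uncurry α))
    (h01 : ∀ x y, 0 ≤ α x y ∧ α x y ≤ 1) (hpos : ∀ x, 0 < acceptRate q α x) {f : X → ℝ} :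
    Integrable f (jumpMeasure q α μ) ↔ Integrable (fun x => acceptRate q α x * f x) μ := by
  have hm : Measurable (acceptRate q α) := measurable_acceptRate hα
  have hc := integral_acceptRate_pos (μ := μ) hα h01 hpos
  rw [jumpMeasure, integrable_withDensity_iff_integrable_smul' (by fun_prop)
    (Eventually.of_forall fun x => ENNReal.ofReal_lt_top),
    ← integrable_const_mul_iff (inv_ne_zero hc.ne').isUnit (fun x => acceptRate q α x * f x)]
  refine integrable_congr (Eventually.of_forall fun x => ?_)
  simp only [smul_eq_mul]
  rw [ENNReal.toReal_ofReal (div_nonneg (hpos x).le hc.le)]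
  ring

/-- The jump kernel is reversible for `μ̃`. -/
theorem isReversible_jumpKernel (hα : Measurable (Function.uncurry α))
    (h01 : ∀ x y, 0 ≤ α x y ∧ α x y ≤ 1) (hpos : ∀ x, 0 < acceptRate q α x)
    (hrev : (mhKernel q α).IsReversible μ) :
    (jumpKernel q α).IsReversible (jumpMeasure q α μ) := by
  have hm : Measurable (acceptRate q α) := measurable_acceptRate hα
  have hc := integral_acceptRate_pos (μ := μ) hα h01 hpos
  set c := ∫ x, acceptRate q α x ∂μ with hcdef
  have hjump : ∀ {A B : Set X}, MeasurableSet A → MeasurableSet B →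
      ∫⁻ x in A, jumpKernel q α x B ∂jumpMeasure q α μ =
        ENNReal.ofReal c⁻¹ *
          ∫⁻ x in A, ENNReal.ofReal (acceptRate q α x) * jumpKernel q α x B ∂μ := by
    intro A B hA hB
    have hmB := Kernel.measurable_coe (jumpKernel q α) hB
    rw [jumpMeasure, restrict_withDensity hA, lintegral_withDensity_eq_lintegral_mul _
      (by fun_prop) hmB, ← lintegral_const_mul _ (by fun_prop)]
    refine lintegral_congr fun x => ?_
    rw [Pi.mul_apply, ← mul_assoc, ← ENNReal.ofReal_mul (inv_nonneg.2 hc.le), div_eq_inv_mul]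
  -- The holding part depends on A ∩ B alone; being symmetric and finite, it cancels from the
  -- reversibility of P.
  have hmh : ∀ {A B : Set X}, MeasurableSet A → MeasurableSet B →
      ∫⁻ x in A, mhKernel q α x B ∂μ =
        ∫⁻ x in A, ENNReal.ofReal (acceptRate q α x) * jumpKernel q α x B ∂μ +
          ∫⁻ x in A ∩ B, ENNReal.ofReal (1 - acceptRate q α x) ∂μ := by
    intro A B hA hB
    have hmB := Kernel.measurable_coe (jumpKernel q α) hB
    rw [Set.inter_comm, ← Measure.restrict_restrict hB, ← lintegral_indicator hB,
      ← lintegral_add_left (by fun_prop)]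
    refine lintegral_congr fun x => ?_
    rw [mhKernel_eq_add hα (hpos x), Measure.add_apply, Measure.smul_apply, Measure.smul_apply,
      Measure.dirac_apply' _ hB]
    by_cases hx : x ∈ B <;> simp [hx]
  intro A B hA hB
  rw [hjump hA hB, hjump hB hA]
  congr 1
  have h1 := hrev hA hB
  rw [hmh hA hB, hmh hB hA, Set.inter_comm B A] at h1
  refine (ENNReal.add_left_inj ?_).1 h1
  refine ((lintegral_mono (g := fun _ => 1) fun x => ?_).trans_lt ?_).ne
  · exact ENNReal.ofReal_le_one.2 (by linarith [hpos x])
  · simp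

end Measure

end Kernels

end MHJump

/-! ### Comparison of P with P̃. -/

namespace MHJump

section Comparison

variable {X : Type*} [MeasurableSpace X] {q : Kernel X X}
  [IsMarkovKernel q] {α : X → X → ℝ} {μ : Measure X} [IsProbabilityMeasure μ]

theorem integral_mul_div_acceptRate (hα : Measurable (Function.uncurry α))
    (h01 : ∀ x y, 0 ≤ α x y ∧ α x y ≤ 1) (hpos : ∀ x, 0 < acceptRate q α x) (h f : X → ℝ) :
    ∫ x, h x * f x ∂μ =
      (∫ x, acceptRate q α x ∂μ) * ∫ x, h x / acceptRate q α x * f x ∂jumpMeasure q α μ := by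
  rw [integral_jumpMeasure hα h01, mul_div_cancel₀ _ (integral_acceptRate_pos hα h01 hpos).ne']
  refine integral_congr_ae (Eventually.of_forall fun x => ?_)
  have := (hpos x).ne'
  field_simp

/-- Integrals of `h ^ 2 / ϱ ^ 2` under `μ̃`. -/
theorem integral_sq_div_acceptRate_sq (hα : Measurable (Function.uncurry α))
    (h01 : ∀ x y, 0 ≤ α x y ∧ α x y ≤ 1) (hpos : ∀ x, 0 < acceptRate q α x) (h : X → ℝ) :
    (∫ x, acceptRate q α x ∂μ) * ∫ x, h x ^ 2 / acceptRate q α x ^ 2 ∂jumpMeasure q α μ =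
      ∫ x, h x ^ 2 / acceptRate q α x ∂μ := by
  rw [integral_jumpMeasure hα h01, mul_div_cancel₀ _ (integral_acceptRate_pos hα h01 hpos).ne']
  refine integral_congr_ae (Eventually.of_forall fun x => ?_)
  have := (hpos x).ne'
  field_simp

theorem memL2Zero_div_acceptRate (hα : Measurable (Function.uncurry α))
    (h01 : ∀ x y, 0 ≤ α x y ∧ α x y ≤ 1) (hpos : ∀ x, 0 < acceptRate q α x) {h : X → ℝ}
    (hh : MemL2Zero μ h) (hint : Integrable (fun x => h x ^ 2 / acceptRate q α x) μ) :
    MemL2Zero (jumpMeasure q α μ) (fun x => h x / acceptRate q α x) := by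
  have hm : Measurable (acceptRate q α) := measurable_acceptRate hα
  refine ⟨?_, ?_⟩
  · have hmeas : AEStronglyMeasurable (fun x => h x / acceptRate q α x) (jumpMeasure q α μ) :=
      (hh.1.1.aemeasurable.div hm.aemeasurable).aestronglyMeasurable.mono_ac
        (withDensity_absolutelyContinuous _ _)
    rw [memLp_two_iff_integrable_sq hmeas, integrable_jumpMeasure_iff hα h01 hpos]
    refine hint.congr (Eventually.of_forall fun x => ?_)
    have := (hpos x).ne'
    field_simp
  · rw [integral_jumpMeasure hα h01, ← zero_div (∫ x, acceptRate q α x ∂μ)]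
    congr 1
    rw [← hh.2]
    exact integral_congr_ae (Eventually.of_forall fun x => mul_div_cancel₀ _ (hpos x).ne')

variable [MeasurableSingletonClass X]

/-- The Dirichlet forms of `P` and `P̃` agree up to the factor `μ(ϱ)`. -/
theorem integral_mul_sub_integral_mhKernel (hα : Measurable (Function.uncurry α))
    (h01 : ∀ x y, 0 ≤ α x y ∧ α x y ≤ 1) (hpos : ∀ x, 0 < acceptRate q α x)
    (hinv : (mhKernel q α).Invariant μ) {f : X → ℝ} (hf : MemLp f 2 μ) :
    ∫ x, f x * (f x - ∫ y, f y ∂mhKernel q α x) ∂μ =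
      (∫ x, acceptRate q α x ∂μ) *
        ∫ x, f x * (f x - ∫ y, f y ∂jumpKernel q α x) ∂jumpMeasure q α μ := by
  have := isMarkovKernel_mhKernel (q := q) hα h01
  rw [integral_jumpMeasure hα h01, mul_div_cancel₀ _ (integral_acceptRate_pos hα h01 hpos).ne']
  refine integral_congr_ae ?_
  filter_upwards [hinv.ae_integrable (hf.integrable one_le_two)] with x hx
  rw [integral_mhKernel hα h01 (hpos x) hx]
  ring

theorem variationalFunctional_mhKernel (hα : Measurable (Function.uncurry α))
    (h01 : ∀ x y, 0 ≤ α x y ∧ α x y ≤ 1) (hpos : ∀ x, 0 < acceptRate q α x)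
    (hinv : (mhKernel q α).Invariant μ) (h : X → ℝ) {f : X → ℝ} (hf : MemLp f 2 μ) :
    variationalFunctional μ (mhKernel q α) h f =
      (∫ x, acceptRate q α x ∂μ) * variationalFunctional (jumpMeasure q α μ) (jumpKernel q α)
        (fun x => h x / acceptRate q α x) f := by
  rw [variationalFunctional, variationalFunctional,
    integral_mul_sub_integral_mhKernel hα h01 hpos hinv hf,
    integral_mul_div_acceptRate hα h01 hpos h f]
  ring

/-- A bound for the variational functional of `P` forces `h ^ 2 / ϱ` to be integrable. -/
theorem integrable_sq_div_acceptRate (hα : Measurable (Function.uncurry α))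
    (h01 : ∀ x y, 0 ≤ α x y ∧ α x y ≤ 1) (hpos : ∀ x, 0 < acceptRate q α x)
    (hrev : (mhKernel q α).IsReversible μ) {h : X → ℝ} (hh : MemLp h 2 μ) {S : ℝ}
    (hS : ∀ f, MemLp f 2 μ → variationalFunctional μ (mhKernel q α) h f ≤ S) :
    Integrable (fun x => h x ^ 2 / acceptRate q α x) μ := by
  have hm : Measurable (acceptRate q α) := measurable_acceptRate hα
  have := isMarkovKernel_mhKernel (q := q) hα h01
  have := isMarkovKernel_jumpKernel (q := q) hα h01 hpos
  have := isProbabilityMeasure_jumpMeasure (q := q) (μ := μ) hα h01 hpos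
  have hinv := hrev.invariant
  have hjinv := (isReversible_jumpKernel hα h01 hpos hrev).invariant
  have hc := integral_acceptRate_pos (q := q) (μ := μ) hα h01 hpos
  let s : ℕ → Set X := fun n => {x | 1 / ((n : ℝ) + 1) < acceptRate q α x}
  have hs : ∀ n, MeasurableSet (s n) := fun n => measurableSet_lt measurable_const hm
  have hcover : AECover μ atTop s := by
    refine ⟨Eventually.of_forall fun x => ?_, hs⟩
    exact tendsto_one_div_add_atTop_nhds_zero_nat.eventually_lt_const (hpos x)
  -- On `s n` the factor 1/(2ϱ) is bounded, so f n is in L²(μ). Among multiples t·h/ϱ, the value t =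
  -- 1/2 maximises the lower bound (2t - 2t²)∫h²/ϱ.
  let f : ℕ → X → ℝ := fun n => (s n).indicator fun x => h x / (2 * acceptRate q α x)
  have hf : ∀ n, MemLp (f n) 2 μ := by
    intro n
    refine hh.of_le_mul (c := (n + 1) / 2) ?_ (Eventually.of_forall fun x => ?_)
    · exact ((hh.1.aemeasurable.div
        (hm.const_mul 2).aemeasurable).indicator (hs n)).aestronglyMeasurable
    · by_cases hx : x ∈ s n
      · have hx' : 1 / ((n : ℝ) + 1) < acceptRate q α x := hx
        rw [div_lt_iff₀ (by positivity)] at hx'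
        simp only [f, Set.indicator_of_mem hx]
        rw [norm_div, Real.norm_of_nonneg (by linarith [hpos x] : 0 ≤ 2 * acceptRate q α x),
          div_le_iff₀ (by linarith [hpos x])]
        nlinarith [norm_nonneg (h x)]
      · simp only [f, Set.indicator_of_notMem hx, norm_zero]
        positivity
  have hsq : ∀ n, Integrable ((s n).indicator fun x => h x ^ 2 / acceptRate q α x) μ := by
    intro n
    refine ((hh.integrable_mul (hf n)).const_mul 2).congr (Eventually.of_forall fun x => ?_)
    have := (hpos x).ne'
    by_cases hx : x ∈ s n
    · simp only [f, Set.indicator_of_mem hx, Pi.mul_apply]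
      field_simp
    · simp [f, hx]
  -- With I the integral of h²/ϱ over `s n`, the linear term is I and the Dirichlet form at most
  -- I/2, whence I ≤ 2S.
  refine hcover.integrable_of_integral_bounded_of_nonneg_ae (2 * S)
    (fun n => (integrable_indicator_iff (hs n)).1 (hsq n))
    (Eventually.of_forall fun x => div_nonneg (sq_nonneg _) (hpos x).le)
    (Eventually.of_forall fun n => ?_)
  have h1 := hS (f n) (hf n)
  have h2 := integral_mul_sub_integral_kernel_le hjinv (memLp_jumpMeasure hα h01 (hf n))
  rw [variationalFunctional, integral_mul_sub_integral_mhKernel hα h01 hpos hinv (hf n)] at h1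
  rw [integral_jumpMeasure hα h01 (fun x => f n x * f n x), ← mul_div_assoc, le_div_iff₀ hc] at h2
  have e1 : ∫ x, h x * f n x ∂μ = (∫ x in s n, h x ^ 2 / acceptRate q α x ∂μ) / 2 := by
    rw [← integral_indicator (hs n), ← integral_div]
    refine integral_congr_ae (Eventually.of_forall fun x => ?_)
    have := (hpos x).ne'
    by_cases hx : x ∈ s n
    · simp only [f, Set.indicator_of_mem hx]
      field_simp
    · simp [f, hx]
  have e2 : ∫ x, acceptRate q α x * (f n x * f n x) ∂μ =
      (∫ x in s n, h x ^ 2 / acceptRate q α x ∂μ) / 4 := by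
    rw [← integral_indicator (hs n), ← integral_div]
    refine integral_congr_ae (Eventually.of_forall fun x => ?_)
    have := (hpos x).ne'
    by_cases hx : x ∈ s n
    · simp only [f, Set.indicator_of_mem hx]
      field_simp
      norm_num
    · simp [f, hx]
  rw [e1] at h1
  rw [e2] at h2
  linarith

/-- The suprema of the variational functionals of `P` and `P̃` agree up to the factor `μ(ϱ)`. -/
theorem isLUB_variationalFunctional_jumpKernel (hα : Measurable (Function.uncurry α))
    (h01 : ∀ x y, 0 ≤ α x y ∧ α x y ≤ 1) (hpos : ∀ x, 0 < acceptRate q α x)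
    (hrev : (mhKernel q α).IsReversible μ) {h : X → ℝ}
    (hg : MemLp (fun x => h x / acceptRate q α x) 2 (jumpMeasure q α μ)) {S : ℝ}
    (hS : IsLUB (variationalFunctional μ (mhKernel q α) h '' {f | MemLp f 2 μ}) S) :
    IsLUB (variationalFunctional (jumpMeasure q α μ) (jumpKernel q α)
      (fun x => h x / acceptRate q α x) '' {f | MemLp f 2 (jumpMeasure q α μ)})
      (S / ∫ x, acceptRate q α x ∂μ) := by
  have := isMarkovKernel_mhKernel (q := q) hα h01
  have := isMarkovKernel_jumpKernel (q := q) hα h01 hpos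
  have := isProbabilityMeasure_jumpMeasure (q := q) (μ := μ) hα h01 hpos
  have hinv := hrev.invariant
  have hjinv := (isReversible_jumpKernel hα h01 hpos hrev).invariant
  have hc := integral_acceptRate_pos (q := q) (μ := μ) hα h01 hpos
  constructor
  · rintro _ ⟨f, hf, rfl⟩
    -- L²(μ̃) may exceed L²(μ), so the bound is checked on simple functions, where the two
    -- functionals are proportional.
    refine variationalFunctional_le_of_forall_simpleFunc hjinv hg (fun u => ?_) hf
    have hu : MemLp u 2 μ := u.memLp_of_isFiniteMeasure _ _
    rw [le_div_iff₀' hc, ← variationalFunctional_mhKernel hα h01 hpos hinv h hu]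
    exact hS.1 ⟨u, hu, rfl⟩
  · intro S' hS'
    rw [div_le_iff₀' hc]
    refine hS.2 ?_
    rintro _ ⟨f, hf, rfl⟩
    rw [variationalFunctional_mhKernel hα h01 hpos hinv h hf]
    exact mul_le_mul_of_nonneg_left (hS' ⟨f, memLp_jumpMeasure hα h01 hf, rfl⟩) hc.le

/-- Comparison of the inefficiencies of a reversible Metropolis–Hastings type kernel and of its
jump chain, for an everywhere positive acceptance rate. -/
theorem hasInefficiency_jumpKernel (hα : Measurable (Function.uncurry α))
    (h01 : ∀ x y, 0 ≤ α x y ∧ α x y ≤ 1) (hpos : ∀ x, 0 < acceptRate q α x)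
    (hrev : (mhKernel q α).IsReversible μ) {h : X → ℝ} (hh : MemL2Zero μ h) {v : ℝ}
    (hv : HasInefficiency μ (mhKernel q α) h v) :
    MemL2Zero (jumpMeasure q α μ) (fun x => h x / acceptRate q α x) ∧
    ∃ w : ℝ,
      HasInefficiency (jumpMeasure q α μ) (jumpKernel q α) (fun x => h x / acceptRate q α x) w ∧
      (∫ x, h x ^ 2 ∂μ) * (1 + v) = (∫ x, acceptRate q α x ∂μ) *
        (∫ x, h x ^ 2 / acceptRate q α x ^ 2 ∂(jumpMeasure q α μ)) * (1 + w) ∧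
      w ≤ v := by
  have := isMarkovKernel_mhKernel (q := q) hα h01
  have := isMarkovKernel_jumpKernel (q := q) hα h01 hpos
  have := isProbabilityMeasure_jumpMeasure (q := q) (μ := μ) hα h01 hpos
  have hc := integral_acceptRate_pos (q := q) (μ := μ) hα h01 hpos
  have hJ := integral_sq_div_acceptRate_sq (q := q) (μ := μ) hα h01 hpos h
  have hsqint : Integrable (fun x => h x ^ 2) μ := hh.1.integrable_sq
  by_cases hm : ∫ x, h x ^ 2 ∂μ = 0
  · have h0 : (fun x => h x ^ 2) =ᵐ[μ] 0 :=
      (integral_eq_zero_iff_of_nonneg (fun x => sq_nonneg _) hsqint).1 hm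
    have h1 : (fun x => h x ^ 2 / acceptRate q α x) =ᵐ[μ] 0 := by
      filter_upwards [h0] with x hx
      simp only [Pi.zero_apply] at hx ⊢
      rw [hx, zero_div]
    have hg := memL2Zero_div_acceptRate hα h01 hpos hh
      ((integrable_zero X ℝ μ).congr h1.symm)
    have hg0 : ∫ x, h x ^ 2 / acceptRate q α x ^ 2 ∂jumpMeasure q α μ = 0 := by
      rw [integral_congr_ae h1] at hJ
      simpa [hc.ne'] using hJ
    have hv1 : v = 1 :=
      tendsto_nhds_unique hv (hasInefficiency_one_of_integral_sq_eq_zero hh.2 hm)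
    refine ⟨hg, 1, hasInefficiency_one_of_integral_sq_eq_zero hg.2 ?_, ?_, hv1.ge⟩
    · simpa only [div_pow] using hg0
    · rw [hm, hg0]
      ring
  · have hLUB := (hasInefficiency_iff_isLUB hrev hh hm v).1 hv
    have hint := integrable_sq_div_acceptRate hα h01 hpos hrev hh.1
      (fun f hf => hLUB.1 ⟨f, hf, rfl⟩)
    have hg := memL2Zero_div_acceptRate hα h01 hpos hh hint
    have hjLUB := isLUB_variationalFunctional_jumpKernel hα h01 hpos hrev hg.1 hLUB
    -- The zero test function; this gives 1 + v ≥ 0, needed for the final inequality.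
    have hS0 : 0 ≤ (∫ x, h x ^ 2 ∂μ) * (1 + v) / 2 :=
      hLUB.1 ⟨fun _ => 0, MemLp.zero, by simp [variationalFunctional]⟩
    have hmpos : 0 < ∫ x, h x ^ 2 ∂μ :=
      (integral_nonneg fun x => sq_nonneg (h x)).lt_of_ne' hm
    have hle : ∫ x, h x ^ 2 ∂μ ≤ ∫ x, h x ^ 2 / acceptRate q α x ∂μ :=
      integral_mono hsqint hint fun x =>
        le_div_self (sq_nonneg _) (hpos x) (acceptRate_le_one hα h01 x)
    rw [← hJ] at hle
    set c := ∫ x, acceptRate q α x ∂μ with hcdef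
    set m := ∫ x, h x ^ 2 ∂μ with hmdef
    set k := ∫ x, h x ^ 2 / acceptRate q α x ^ 2 ∂jumpMeasure q α μ with hkdef
    have hck : 0 < c * k := hmpos.trans_le hle
    have hk : k ≠ 0 := fun h0 => by simp [h0] at hck
    have hgk : ∫ x, (h x / acceptRate q α x) ^ 2 ∂jumpMeasure q α μ = k := by
      simp only [hkdef, div_pow]
    -- The witness w is the claimed identity solved for w.
    refine ⟨hg, m * (1 + v) / (c * k) - 1, ?_, ?_, ?_⟩
    · rw [hasInefficiency_iff_isLUB (isReversible_jumpKernel hα h01 hpos hrev) hg (by rwa [hgk]),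
        hgk]
      convert hjLUB using 1
      field_simp
      ring
    · field_simp
      ring
    · have hv0 : 0 ≤ 1 + v := by
        by_contra! hneg
        nlinarith
      have : m * (1 + v) / (c * k) ≤ 1 + v := by
        rw [div_le_iff₀ hck]
        nlinarith
      linarith

end Comparison

end MHJump

theorem proposition2 {d : ℕ}
    (μ : Measure (EuclideanSpace ℝ (Fin d))) [IsProbabilityMeasure μ]
    (hμ : ∀ x, μ {x} ≠ 1)
    (q : Kernel (EuclideanSpace ℝ (Fin d)) (EuclideanSpace ℝ (Fin d))) [IsMarkovKernel q]
    (hq : ∀ x, q x {x} = 0)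
    (α : EuclideanSpace ℝ (Fin d) → EuclideanSpace ℝ (Fin d) → ℝ)
    (hα_meas : Measurable (Function.uncurry α))
    (hα : ∀ x y, 0 ≤ α x y ∧ α x y ≤ 1)
    (hrev : (MHJump.mhKernel q α).IsReversible μ)
    (hP : MHJump.IsErgodic μ (MHJump.mhKernel q α))
    (hPjump : MHJump.IsErgodic (MHJump.jumpMeasure q α μ) (MHJump.jumpKernel q α))
    (h : EuclideanSpace ℝ (Fin d) → ℝ)
    (hh : MHJump.MemL2Zero μ h)
    (v : ℝ) (hv : MHJump.HasInefficiency μ (MHJump.mhKernel q α) h v) :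
    MHJump.MemL2Zero (MHJump.jumpMeasure q α μ) (fun x => h x / MHJump.acceptRate q α x) ∧
    ∃ w : ℝ,
      MHJump.HasInefficiency (MHJump.jumpMeasure q α μ) (MHJump.jumpKernel q α)
        (fun x => h x / MHJump.acceptRate q α x) w ∧
      (∫ x, h x ^ 2 ∂μ) * (1 + v) =
        (∫ x, MHJump.acceptRate q α x ∂μ) *
          (∫ x, h x ^ 2 / MHJump.acceptRate q α x ^ 2 ∂(MHJump.jumpMeasure q α μ)) * (1 + w) ∧
      w ≤ v :=
  MHJump.hasInefficiency_jumpKernel hα_meas hα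
    (MHJump.acceptRate_pos hμ hα_meas hα hP) hrev hh hv
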